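/- **Conventions.** Let $\Sigma=\{0,1\}$. A function $F:\subseteq\Sigma^\omega\to\Sigma^\omega$ is computable if some Turing machine with one-way output transforms each $p\in\operatorname{dom}F$ into $F(p)$. For representations (surjective partial functions) $\delta,\delta':\subseteq\Sigma^\omega\to X$, $\delta$ is *reducible* to $\delta'$, $\delta\le\delta'$, if there is a computable $F:\subseteq\Sigma^\omega\to\Sigma^\omega$ with $\delta(p)=\delta'(F(p))$ for all $p\in\operatorname{dom}\delta$. Put $\delta_{\mathbb N}(1^n0^\omega)=n$, $\delta^{\mathbb N}=[\delta_{\mathbb N}\to\delta]$ (the function space representation of sequences), and let $\mathbb F$ be $\mathbb R$ or $\mathbb C$, with the Cauchy representations $\delta_{\mathbb R}$, $\delta_{\mathbb F}$ belonging to the standard numberings $\alpha_{\mathbb R}$ of $\mathbb Q$ and $\alpha_{\mathbb F}$ of the rational points of $\mathbb F$. The Cauchy representation belonging to a dense sequence $\alpha$ in a metric space is $01^{n_0+1}01^{n_1+1}\dots\mapsto\lim_i\alpha(n_i)$, defined when the limit exists and $d(\alpha(n_i),\alpha(n_j))<2^{-i}$ for all $j>i$. Sequences are computable if a name of the $n$-th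 member can be computed from $n$. A *computable Hilbert space* $(H,\langle\cdot,\cdot\rangle,u)$ is a Hilbert space over $\mathbb F$ with a sequence $u=(u_j)_{j\in\mathbb N}$ whose linear span is dense, such that, for the numbering $\alpha_u\langle k,\langle n_0,\dots,n_k\rangle\rangle=\sum_{j\le k}\alpha_{\mathbb F}(n_j)u_j$, the sequence $\alpha_u$ is dense in $H$ and the real double sequence $\|\alpha_u(a)-\alpha_u(b)\|$ is computable; $\delta_H$ is the Cauchy representation belonging to $\alpha_u$. **Theorem 3.3.** Let $(H_i,\langle\cdot,\cdot\rangle,u_i)_{i\in\mathbb N}$ be a computable sequence of computable Hilbert spaces, that is, $\|\alpha_{u_i}(a)-\alpha_{u_i}(b)\|$ is computable uniformly in $i,a,b$. For each $i$ let $(e_{ij})_{j\in\mathbb N}$ be an orthonormal basis of $H_i$ (filled up with zero vectors if $H_i$ has finite dimension), such that a $\delta_{H_i}$-name of $e_{ij}$ is computable uniformly in $i,j$. On $$\Big(\sum_{i\in\mathbb N}\oplus H_i\Big)_{l_2}=\Big\{(f_i): f_i\in H_i,\ \sum_{i\in\mathbb N}\|f_i\|^2<\infty\Big\}$$ consider the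 representations $$\delta_{(\sum\oplus H_i)_{l_2}}(\langle\langle p_0,p_1,\dots\rangle,q\rangle)=(f_i)\iff \delta_{H_i}(p_i)=f_i\ \text{for all } i\in\mathbb N\ \text{ and }\ \delta_{\mathbb R}(q)=\sum_{i\in\mathbb N}\|f_i\|^2,$$ $$\delta_{\mathrm{Fourier}}(\langle p,q\rangle)=(f_i)\iff (\delta_{\mathbb F}^{\mathbb N})^{\mathbb N}(p)=\big((\langle f_i,e_{ij}\rangle)_{j}\big)_{i}\ \text{ and }\ \delta_{\mathbb R}(q)=\sum_{i\in\mathbb N}\|f_i\|^2 .$$ Then $\delta_{(\sum\oplus H_i)_{l_2}}\le\delta_{\mathrm{Fourier}}$. -/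

import Mathlib

open Filter Topology

/-! ### Infinite strings and computable functions on them

The alphabet is `{0, 1}`, with `false` for `0` and `true` for `1`. -/

/-- The space `Σ^ω` of infinite binary sequences. -/
abbrev Cantor : Type := ℕ → Bool

/-- The finite word `w` is an initial segment of the infinite string `p`. -/
def IsInit (w : List Bool) (p : Cantor) : Prop :=
  w = (List.range w.length).map p

/-- The initial segment of length `n` of `p`. -/
def initSeg (p : Cantor) (n : ℕ) : List Bool :=
  (List.range n).map p

/-- The (partial) word function `h` maps `p` to `q`: all words which `h` produces from initial
segments of `p` are initial segments of `q`, and there are arbitrarily long such words. -/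
def Generates (h : List Bool →. List Bool) (p q : Cantor) : Prop :=
  (∀ n, ∀ v ∈ h (initSeg p n), IsInit v q) ∧
    ∀ k, ∃ n, ∃ v ∈ h (initSeg p n), k ≤ v.length

/-- Computability of a partial function `F : ⊆ Σ^ω → Σ^ω` by a machine that computes infinitely
long, with one-way output. The word function `h` maps a finite part of the input to the
output that is written on account of this part; it is computable and monotone, and `F p`
is the limit of the words `h (p 0 … p (n - 1))`, being defined exactly if these words get
arbitrarily long. -/
def ComputableFun (F : Cantor →. Cantor) : Prop :=
  ∃ h : List Bool → List Bool, Computable h ∧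
    (∀ v w : List Bool, v <+: w → h v <+: h w) ∧
    ∀ p q : Cantor, q ∈ F p ↔ Generates (fun w => Part.some (h w)) p q

/-- `⟨p, q⟩ = p 0, q 0, p 1, q 1, …`. -/
def pairStr (p q : Cantor) : Cantor :=
  fun n => if n % 2 = 0 then p (n / 2) else q (n / 2)

/-- The component `p_i` of `p = ⟨p_0, p_1, p_2, …⟩`, where
`⟨p_0, p_1, p_2, …⟩ ⟨i, j⟩ = p_i j`. -/
def component (p : Cantor) (i : ℕ) : Cantor :=
  fun j => p (Nat.pair i j)

/-! ### Representations -/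

/-- The graph of a naming system `δ : ⊆ Σ^ω → X`: `δ p x` says that `p ∈ dom δ` and
`δ(p) = x`. -/
abbrev Naming (X : Type*) : Type _ := Cantor → X → Prop

/-- `δ ≤ δ'`: some computable `F : ⊆ Σ^ω → Σ^ω` satisfies `δ(p) = δ'(F(p))` for all
`p ∈ dom δ`. -/
def Reducible {X : Type*} (δ δ' : Naming X) : Prop :=
  ∃ F : Cantor →. Cantor, ComputableFun F ∧
    ∀ p x, δ p x → ∃ q ∈ F p, δ' q x

/-- The string `1^n 0^ω`. -/
def natStr (n : ℕ) : Cantor := fun k => decide (k < n)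

/-- The representation `δ_ℕ(1^n 0^ω) = n` of the natural numbers. -/
def natRep : Naming ℕ := fun p n => p = natStr n

/-- A sequence of points `x n`, each in a space `X n` with representation `δ n`, is computable
if a `δ n`-name of `x n` can be computed from the `δ_ℕ`-name of `n`, uniformly in `n`.
(For a constant family `X` this says that `x : ℕ → X` is a computable sequence.) -/
def ComputableSeq {X : ℕ → Type*} (δ : ∀ n, Naming (X n)) (x : ∀ n, X n) : Prop :=
  ∃ F : Cantor →. Cantor, ComputableFun F ∧
    ∀ n, ∃ q ∈ F (natStr n), δ n q (x n)

/-- The word function computed by the program `c`. -/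
def wordFun (c : Nat.Partrec.Code) : List Bool →. List Bool :=
  fun w => (c.eval (Encodable.encode w)).bind
    fun m => (Encodable.decode (α := List Bool) m : Part (List Bool))

/-- The standard numbering `η` of continuous partial functions on `Σ^ω` by infinite strings:
`p = ⟨c, r⟩` consists of a program `c` and a parameter `r`, and `η_p(y)` is the result of `c` on
`⟨r, y⟩`. The relation says that `η_p(y) = q`. -/
def Eta (p y q : Cantor) : Prop :=
  ∃ (c : Nat.Partrec.Code) (r : Cantor),
    p = pairStr (natStr (Encodable.encode c)) r ∧ Generates (wordFun c) (pairStr r y) q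

/-- The function space representation `[δ → δ']`: a string `p` is a name of `f` if `η_p`
is a realizer of `f`, i.e. `δ'(η_p(y)) = f(δ(y))` for all `y ∈ dom δ`. -/
def funRep {X Y : Type*} (δ : Naming X) (δ' : Naming Y) : Naming (X → Y) :=
  fun p f => ∀ y x, δ y x → ∃ q, Eta p y q ∧ δ' q (f x)

/-- The representation `δ^ℕ = [δ_ℕ → δ]` of the sequences in `X`. -/
def seqRep {X : Type*} (δ : Naming X) : Naming (ℕ → X) := funRep natRep δ

/-! ### Computable metric spaces and computable Hilbert spaces -/

/-- The word `0 1^(n 0 + 1) 0 1^(n 1 + 1) … 0 1^(n (k - 1) + 1)`. -/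
def blocks (n : ℕ → ℕ) (k : ℕ) : List Bool :=
  (List.range k).flatMap fun i => false :: List.replicate (n i + 1) true

/-- The Cauchy representation belonging to `α : ℕ → X`:
`δ(0 1^(n 0 + 1) 0 1^(n 1 + 1) 0 1^(n 2 + 1) …) = lim α (n i)`, for all `n` such that
`α (n i)` converges and `d(α (n i), α (n j)) < 2^(-i)` for `j > i`. -/
def cauchyRep {X : Type*} [MetricSpace X] (α : ℕ → X) : Naming X :=
  fun p x => ∃ n : ℕ → ℕ, (∀ k, IsInit (blocks n k) p) ∧
    (∀ i j, i < j → dist (α (n i)) (α (n j)) < (1 / 2 : ℝ) ^ i) ∧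
    Tendsto (fun i => α (n i)) atTop (𝓝 x)

/-- The numbering `α_ℝ ⟨⟨i, j⟩, k⟩ = (i - j) / (k + 1)` of the rational numbers. -/
noncomputable def ratNum (n : ℕ) : ℝ :=
  ((n.unpair.1.unpair.1 : ℝ) - (n.unpair.1.unpair.2 : ℝ)) / ((n.unpair.2 : ℝ) + 1)

/-- The standard numbering `α_𝔽` of a dense subset of the field `𝔽` of scalars: it is `α_ℝ` for
the real numbers, and `α_ℂ ⟨a, b⟩ = α_ℝ a + α_ℝ b · i` for the complex numbers. -/
noncomputable def scalarNum (𝕜 : Type*) [RCLike 𝕜] (n : ℕ) : 𝕜 :=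
  open Classical in
  if (RCLike.I : 𝕜) = 0 then (ratNum n : 𝕜)
  else (ratNum n.unpair.1 : 𝕜) + (ratNum n.unpair.2 : 𝕜) * RCLike.I

/-- The Cauchy representation `δ_ℝ`. -/
noncomputable def realRep : Naming ℝ := cauchyRep ratNum

/-- The Cauchy representation `δ_𝔽`. -/
noncomputable def scalarRep (𝕜 : Type*) [RCLike 𝕜] : Naming 𝕜 := cauchyRep (scalarNum 𝕜)

/-- `(X, d, α)` is a computable metric space. -/
structure IsComputableMetricSpace {X : Type*} [MetricSpace X] (α : ℕ → X) : Prop where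
  dense : DenseRange α
  computable_dist :
    ComputableSeq (fun _ => realRep) fun n => dist (α n.unpair.1) (α n.unpair.2)

section Hilbert

variable (𝕜 : Type*) [RCLike 𝕜]

/-- `linComb 𝕜 e k ⟨n_0, …, n_k⟩ = α_𝔽(n_0) e_0 + … + α_𝔽(n_k) e_k`, where
`⟨n_0, …, n_k, n_(k+1)⟩ = ⟨⟨n_0, …, n_k⟩, n_(k+1)⟩`. -/
noncomputable def linComb {H : Type*} [NormedAddCommGroup H] [InnerProductSpace 𝕜 H]
    (e : ℕ → H) : ℕ → ℕ → H
  | 0, m => scalarNum 𝕜 m • e 0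
  | k + 1, m => linComb e k m.unpair.1 + scalarNum 𝕜 m.unpair.2 • e (k + 1)

/-- The numbering `α_e ⟨k, ⟨n_0, …, n_k⟩⟩ = α_𝔽(n_0) e_0 + … + α_𝔽(n_k) e_k`. -/
noncomputable def spanNum {H : Type*} [NormedAddCommGroup H] [InnerProductSpace 𝕜 H]
    (e : ℕ → H) (n : ℕ) : H :=
  linComb 𝕜 e n.unpair.1 n.unpair.2

/-- The Cauchy representation `δ_H` of the space `H` with fundamental sequence `e`. -/
noncomputable def hilbertRep {H : Type*} [NormedAddCommGroup H] [InnerProductSpace 𝕜 H]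
    (e : ℕ → H) : Naming H :=
  cauchyRep (spanNum 𝕜 e)

/-- `(H, ⟨·,·⟩, e)` is a computable Hilbert space. -/
structure IsComputableHilbertSpace {H : Type*} [NormedAddCommGroup H] [InnerProductSpace 𝕜 H]
    (e : ℕ → H) : Prop where
  complete : CompleteSpace H
  dense_span : Dense (Submodule.span 𝕜 (Set.range e) : Set H)
  computable_metric : IsComputableMetricSpace (spanNum 𝕜 e)

/-- `(H i, ⟨·,·⟩, u i)`, `i ∈ ℕ`, is a computable sequence of computable Hilbert spaces: the
computability of the distances is uniform in `i`. The index `n` stands for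
`⟨i, ⟨a, b⟩⟩`. -/
structure IsComputableHilbertSeq {H : ℕ → Type*} [∀ i, NormedAddCommGroup (H i)]
    [∀ i, InnerProductSpace 𝕜 (H i)] (u : ∀ i, ℕ → H i) : Prop where
  each : ∀ i, IsComputableHilbertSpace 𝕜 (u i)
  uniform : ComputableSeq (fun _ => realRep) fun n =>
    dist (spanNum 𝕜 (u n.unpair.1) n.unpair.2.unpair.1)
      (spanNum 𝕜 (u n.unpair.1) n.unpair.2.unpair.2)

/-- `(e j)` is an orthonormal basis of `H`, indexed by `ℕ`; so that `H` may also have finite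
dimension, a basis may be filled up with zero vectors. -/
structure IsOrthonormalBasis {H : Type*} [NormedAddCommGroup H] [InnerProductSpace 𝕜 H]
    (e : ℕ → H) : Prop where
  norm_eq : ∀ j, ‖e j‖ = 1 ∨ e j = 0
  orthogonal : ∀ j k, j ≠ k → inner 𝕜 (e j) (e k) = 0
  dense_span : Dense (Submodule.span 𝕜 (Set.range e) : Set H)

variable {H : ℕ → Type*} [∀ i, NormedAddCommGroup (H i)] [∀ i, InnerProductSpace 𝕜 (H i)]

/-- `(e i j)` are orthonormal bases of the spaces `H i` with fundamental sequences `u i`, and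
`e i j` is computable in `H i`, uniformly in `i` and `j`. -/
structure IsComputableBasisSeq (u e : ∀ i, ℕ → H i) : Prop where
  basis : ∀ i, IsOrthonormalBasis 𝕜 (e i)
  computable : ComputableSeq (fun n => hilbertRep 𝕜 (u n.unpair.1))
    fun n => e n.unpair.1 n.unpair.2

/-! ### The two representations of the direct sum

`lp H 2` is the `ℓ²`-direct sum of the spaces `H i`. -/

/-- `δ(⟨⟨p_0, p_1, …⟩, q⟩) = (f_i)` iff `δ_{H_i}(p_i) = f_i` for all `i` and
`δ_ℝ(q) = ∑ ‖f_i‖²`. -/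
noncomputable def sumRep (u : ∀ i, ℕ → H i) : Naming (lp H 2) :=
  fun s f => ∃ p q, s = pairStr p q ∧
    (∀ i, hilbertRep 𝕜 (u i) (component p i) (f i)) ∧ realRep q (∑' i, ‖f i‖ ^ 2)

/-- `δ_Fourier(⟨p, q⟩) = (f_i)` iff `(δ_𝔽^ℕ)^ℕ(p) = ((⟨f_i, e_ij⟩)_j)_i` and
`δ_ℝ(q) = ∑ ‖f_i‖²`. (The inner product of Mathlib is linear in its second argument.) -/
noncomputable def fourierRep (e : ∀ i, ℕ → H i) : Naming (lp H 2) :=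
  fun s f => ∃ p q, s = pairStr p q ∧
    seqRep (seqRep (scalarRep 𝕜)) p (fun i j => inner 𝕜 (e i j) (f i)) ∧
    realRep q (∑' i, ‖f i‖ ^ 2)

end Hilbert

/-! The reduction keeps the name `s` of `(f_i)` as a parameter and postpones all work: `s = ⟨p, q⟩`
is mapped to `⟨⟨c₁, s⟩, q⟩`, where `c₁` is a program that maps `⟨s, i⟩` to `⟨c₂, ⟨s, i⟩⟩`
(`exists_eta_curry`), and `c₂` is a program that computes a name of `⟨e_ij, f_i⟩` from
`⟨⟨s, i⟩, j⟩` (`exists_generates_coeff`). Both `c₁` and the reduction itself only rearrange the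
symbols of their input (`rewire`).

For `c₂`, computability of the distances yields approximations to `‖x‖`, `‖y‖` and `‖x - y‖` for
all linear combinations `x`, `y` of the fundamental sequence, hence to the inner products
`⟨x, y⟩` by the polarization identity; a complex scalar requires in addition that indices can be
multiplied by the imaginary unit (`IsComputableHilbertSeq.exists_inner`). If `x` is close to
`e_ij` and `y` is close to `f_i`, then `⟨x, y⟩` is close to `⟨e_ij, f_i⟩`. How close it is depends
on a bound for `‖f_i‖`, which can be read off from the first entry of the name of `f_i`.

The data that do not depend on `s` (distances and basis vectors) are turned into total computable
functions on `ℕ` by unbounded search (`ComputableSeq.exists_approx`). The data contained in `s`, `i`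
and `j` are parsed from longer and longer initial segments of the input. Each attempt either fails
or gives the right value, and all late attempts succeed: this is the notion `Detects`, which is
stable under composition, and from which the output name is produced in
`exists_generates_blocks`. -/

/-! ### Initial segments -/

@[simp] lemma length_initSeg (p : Cantor) (n : ℕ) : (initSeg p n).length = n := by
  simp [initSeg]

lemma isInit_iff {w : List Bool} {p : Cantor} : IsInit w p ↔ w = initSeg p w.length := Iff.rfl

lemma isInit_initSeg (p : Cantor) (n : ℕ) : IsInit (initSeg p n) p := by
  simp [isInit_iff]

lemma getElem?_initSeg (p : Cantor) (n m : ℕ) :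
    (initSeg p n)[m]? = if m < n then some (p m) else none := by
  split_ifs with h
  · simp [initSeg, h]
  · simp [initSeg, not_lt.1 h]

lemma initSeg_succ (p : Cantor) (n : ℕ) : initSeg p (n + 1) = initSeg p n ++ [p n] := by
  simp [initSeg, List.range_succ]

lemma initSeg_prefix (p : Cantor) {m n : ℕ} (h : m ≤ n) : initSeg p m <+: initSeg p n := by
  induction n, h using Nat.le_induction with
  | base => exact List.prefix_refl _
  | succ n _ ih => exact ih.trans (initSeg_succ p n ▸ List.prefix_append _ _)

/-- Two initial segments of the same string are comparable. -/
lemma IsInit.prefix_of_length_le {v w : List Bool} {p : Cantor} (hv : IsInit v p)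
    (hw : IsInit w p) (h : v.length ≤ w.length) : v <+: w := by
  rw [isInit_iff] at hv hw
  rw [hv, hw]
  exact initSeg_prefix p h

lemma IsInit.of_prefix {v w : List Bool} {p : Cantor} (hw : IsInit w p) (h : v <+: w) :
    IsInit v p := by
  have h' := List.prefix_iff_eq_take.1 h
  have hl := h.length_le
  rw [isInit_iff] at hw ⊢
  rw [hw] at h'
  have := List.prefix_iff_eq_take.1 (initSeg_prefix p hl)
  rw [length_initSeg] at this
  rw [this]; exact h'

lemma exists_isInit (w : List Bool) : ∃ p : Cantor, IsInit w p := by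
  refine ⟨fun n => w.getD n false, ?_⟩
  apply List.ext_getElem (by simp)
  intro n h1 h2
  simp [h1]

/-- A string is determined by the words `h (p 0 … p (n - 1))` generating it. -/
lemma Generates.unique {h : List Bool →. List Bool} {p q q' : Cantor} (hq : Generates h p q)
    (hq' : Generates h p q') : q = q' := by
  funext k
  obtain ⟨n, v, hv, hk⟩ := hq.2 (k + 1)
  have h1 := hq.1 n v hv
  have h2 := hq'.1 n v hv
  rw [isInit_iff] at h1 h2
  have : (initSeg q v.length)[k]? = (initSeg q' v.length)[k]? := by rw [← h1, ← h2]
  have hk : k < v.length := hk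
  rw [getElem?_initSeg, getElem?_initSeg, if_pos hk, if_pos hk] at this
  exact Option.some.inj this

/-! ### Finding an object from longer and longer words -/

/-- The attempts `g 0, g 1, …` to find an object never give an object other than `a`, and from
some time on they all give `a`. -/
def Detects {α : Type*} (g : ℕ → Option α) (a : α) : Prop :=
  (∀ l b, g l = some b → b = a) ∧ ∀ᶠ l in atTop, g l = some a

lemma Detects.some {α : Type*} (a : α) : Detects (fun _ => some a) a := by
  simp [Detects, eq_comm]

lemma Detects.bind {α β : Type*} {g : ℕ → Option α} {a : α} (hg : Detects g a)
    {h : ℕ → α → Option β} {b : β} (hh : Detects (fun l => h l a) b) :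
    Detects (fun l => (g l).bind (h l)) b := by
  constructor
  · intro l c hc
    obtain ⟨a', ha', hc⟩ := Option.bind_eq_some_iff.1 hc
    rw [hg.1 l a' ha'] at hc
    exact hh.1 l c hc
  · filter_upwards [hg.2, hh.2] with l h1 h2
    simp [h1, h2]

lemma Detects.map {α β : Type*} {g : ℕ → Option α} {a : α} (hg : Detects g a) (h : α → β) :
    Detects (fun l => (g l).map h) (h a) := by
  simpa [Option.map_eq_bind, Function.comp_def] using
    hg.bind (h := fun _ x => Option.some (h x)) (Detects.some (h a))

/-- The words `W 0, W 1, …` are initial segments of `q`, with lengths tending to infinity. -/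
def Approaches (W : ℕ → List Bool) (q : Cantor) : Prop :=
  (∀ l, IsInit (W l) q) ∧ Tendsto (fun l => (W l).length) atTop atTop

/-- The words which a monotone word function produces approach the generated string. -/
lemma Generates.approaches {h : List Bool → List Bool} (hm : ∀ v w, v <+: w → h v <+: h w)
    {p q : Cantor} (hg : Generates (fun w => Part.some (h w)) p q) :
    Approaches (fun l => h (initSeg p l)) q := by
  refine ⟨fun l => hg.1 l _ (Part.mem_some _), tendsto_atTop.2 fun k => ?_⟩
  obtain ⟨n, v, hv, hk⟩ := hg.2 k
  rw [Part.mem_some_iff] at hv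
  subst hv
  filter_upwards [eventually_ge_atTop n] with l hl
  exact hk.trans (hm _ _ (initSeg_prefix p hl)).length_le

/-! ### Parsing names -/

/-- The lengths of the runs of `true` in a word which are completed by `false`, together with
the length of the last run, which is still open. -/
def runs (w : List Bool) : List ℕ × ℕ :=
  w.foldl (fun s b => cond b (s.1, s.2 + 1) (s.1 ++ [s.2], 0)) ([], 0)

lemma runs_append_true (w : List Bool) : runs (w ++ [true]) = ((runs w).1, (runs w).2 + 1) := by
  simp [runs]

lemma runs_append_false (w : List Bool) : runs (w ++ [false]) = ((runs w).1 ++ [(runs w).2], 0) := by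
  simp [runs]

lemma runs_append_replicate (w : List Bool) (n : ℕ) :
    runs (w ++ List.replicate n true) = ((runs w).1, (runs w).2 + n) := by
  induction n with
  | zero => simp
  | succ n ih =>
    rw [List.replicate_succ', ← List.append_assoc, runs_append_true, ih, Nat.add_assoc]

lemma runs_prefix {v w : List Bool} (h : v <+: w) : (runs v).1 <+: (runs w).1 := by
  obtain ⟨u, rfl⟩ := h
  induction u using List.reverseRecOn with
  | nil => simp
  | append_singleton u b ih =>
    rw [← List.append_assoc]
    cases b
    · rw [runs_append_false]; exact ih.trans (List.prefix_append _ _)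
    · rw [runs_append_true]; exact ih

lemma primrec_runs : Primrec runs := by
  unfold runs
  refine Primrec.list_foldl (h := fun (_ : List Bool) (x : (List ℕ × ℕ) × Bool) =>
    cond x.2 (x.1.1, x.1.2 + 1) (x.1.1 ++ [x.1.2], 0)) Primrec.id (Primrec.const _) ?_
  have h1 : Primrec fun a : List Bool × ((List ℕ × ℕ) × Bool) => a.2.1.1 :=
    Primrec.fst.comp (Primrec.fst.comp Primrec.snd)
  have h2 : Primrec fun a : List Bool × ((List ℕ × ℕ) × Bool) => a.2.1.2 :=
    Primrec.snd.comp (Primrec.fst.comp Primrec.snd)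
  exact Primrec.cond (Primrec.snd.comp Primrec.snd) (h1.pair (Primrec.succ.comp h2))
    ((Primrec.list_concat.comp h1 h2).pair (Primrec.const 0))

/-- The completed run number `k` of a word. -/
def runAt (w : List Bool) (k : ℕ) : Option ℕ := (runs w).1[k]?

lemma primrec_runAt : Primrec₂ runAt :=
  Primrec.list_getElem?.comp (Primrec.fst.comp (primrec_runs.comp Primrec.fst)) Primrec.snd

lemma List.IsPrefix.getElem?_of_some {α : Type*} {l l' : List α} (h : l <+: l') {k : ℕ} {a : α}
    (ha : l[k]? = some a) : l'[k]? = some a := by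
  obtain ⟨t, rfl⟩ := h
  have := (List.getElem?_eq_some_iff.1 ha).1
  rw [List.getElem?_append_left this, ha]

/-- If a run is complete in an initial segment of `q`, it is detected from words approaching
`q`. -/
lemma Approaches.detects_runAt {W : ℕ → List Bool} {q : Cantor} (hW : Approaches W q)
    {w : List Bool} (hw : IsInit w q) {k a : ℕ} (ha : runAt w k = some a) :
    Detects (fun l => runAt (W l) k) a := by
  constructor
  · intro l b hb
    rcases le_total (W l).length w.length with h | h
    · have := (runs_prefix ((hW.1 l).prefix_of_length_le hw h)).getElem?_of_some hb
      exact Option.some.inj (this.symm.trans ha)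
    · have := (runs_prefix (hw.prefix_of_length_le (hW.1 l) h)).getElem?_of_some ha
      exact Option.some.inj (hb.symm.trans this)
  · filter_upwards [hW.2.eventually_ge_atTop w.length] with l hl
    exact (runs_prefix (hw.prefix_of_length_le (hW.1 l) hl)).getElem?_of_some ha

lemma initSeg_natStr_of_le {n l : ℕ} (h : l ≤ n) :
    initSeg (natStr n) l = List.replicate l true := by
  refine List.ext_getElem (by simp) fun m h1 h2 => ?_
  simp only [length_initSeg] at h1
  simp [initSeg, natStr, h1.trans_le h]

/-- The name of `n` starts with a run of length `n`. -/
lemma Approaches.detects_nat {W : ℕ → List Bool} {n : ℕ} (hW : Approaches W (natStr n)) :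
    Detects (fun l => runAt (W l) 0) n := by
  refine hW.detects_runAt (isInit_initSeg _ (n + 1)) ?_
  have h : initSeg (natStr n) (n + 1) = List.replicate n true ++ [false] := by
    rw [initSeg_succ, initSeg_natStr_of_le le_rfl]
    simp [natStr]
  have h' := runs_append_replicate [] n
  rw [List.nil_append] at h'
  rw [runAt, h, runs_append_false, h']
  simp [runs]

lemma blocks_succ (n : ℕ → ℕ) (k : ℕ) :
    blocks n (k + 1) = blocks n k ++ [false] ++ List.replicate (n k + 1) true := by
  simp [blocks, List.range_succ]

lemma runs_blocks_succ (n : ℕ → ℕ) (k : ℕ) :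
    runs (blocks n (k + 1)) = (0 :: (List.range k).map (fun i => n i + 1), n k + 1) := by
  induction k with
  | zero =>
    rw [blocks_succ, runs_append_replicate, runs_append_false]
    simp [blocks, runs]
  | succ k ih =>
    rw [blocks_succ, runs_append_replicate, runs_append_false, ih]
    simp [List.range_succ]

/-- The run of length `n k + 1` in the name `0 1^(n 0 + 1) 0 1^(n 1 + 1) …` has number `k + 1`,
the empty run before the first `0` having number `0`. -/
lemma Approaches.detects_block {W : ℕ → List Bool} {q : Cantor} (hW : Approaches W q)
    {n : ℕ → ℕ} (hn : ∀ k, IsInit (blocks n k) q) (k : ℕ) :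
    Detects (fun l => (runAt (W l) (k + 1)).map Nat.pred) (n k) := by
  refine (hW.detects_runAt (hn (k + 2)) (k := k + 1) (a := n k + 1) ?_).map Nat.pred
  rw [runAt, runs_blocks_succ]
  simp

/-! ### Writing names -/

lemma blocks_prefix (n : ℕ → ℕ) {k l : ℕ} (h : k ≤ l) : blocks n k <+: blocks n l := by
  induction l, h using Nat.le_induction with
  | base => exact List.prefix_refl _
  | succ l _ ih =>
    rw [blocks_succ, List.append_assoc]
    exact ih.trans (List.prefix_append _ _)

lemma le_length_blocks (n : ℕ → ℕ) (k : ℕ) : k ≤ (blocks n k).length := by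
  induction k with
  | zero => simp
  | succ k ih => rw [blocks_succ]; simp; omega

lemma exists_name (n : ℕ → ℕ) : ∃ q : Cantor, ∀ k, IsInit (blocks n k) q := by
  refine ⟨fun m => (blocks n (m + 1)).getD m false, fun k => ?_⟩
  refine List.ext_getElem (by simp) fun m h1 h2 => ?_
  have hm : m < (blocks n (m + 1)).length := le_length_blocks n (m + 1)
  have e1 := List.getElem?_eq_getElem h1
  have e2 := List.getElem?_eq_getElem hm
  have : (blocks n k)[m] = (blocks n (m + 1))[m] := by
    rcases le_total k (m + 1) with h | h
    · have := (blocks_prefix n h).getElem?_of_some e1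
      exact Option.some.inj (this.symm.trans e2)
    · have := (blocks_prefix n h).getElem?_of_some e2
      exact Option.some.inj (e1.symm.trans this)
  simp [this, hm]

/-- The first `K` blocks of a name, provided that the numbers `a 0, …, a (K - 1)` are available. -/
def blocksOpt (a : ℕ → Option ℕ) (K : ℕ) : Option (List Bool) :=
  Nat.rec (some []) (fun k v => v.bind fun v => (a k).map fun m =>
    v ++ [false] ++ (List.range (m + 1)).map fun _ => true) K

lemma blocksOpt_eq {a : ℕ → Option ℕ} {n : ℕ → ℕ} {K : ℕ} (h : ∀ k < K, a k = some (n k)) :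
    blocksOpt a K = some (blocks n K) := by
  induction K with
  | zero => simp [blocksOpt, blocks]
  | succ K ih =>
    have := ih fun k hk => h k (hk.trans K.lt_succ_self)
    rw [blocksOpt] at this ⊢
    simp only [this, h K K.lt_succ_self, blocks_succ]
    simp [List.map_const']

lemma eq_blocks_of_blocksOpt {a : ℕ → Option ℕ} {n : ℕ → ℕ} (h : ∀ k m, a k = some m → m = n k)
    {K : ℕ} {v : List Bool} (hv : blocksOpt a K = some v) : v = blocks n K := by
  have : ∀ k < K, a k = some (n k) := by
    induction K generalizing v with
    | zero => simp
    | succ K ih =>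
      obtain ⟨v', hv', hv⟩ := Option.bind_eq_some_iff.1 hv
      obtain ⟨m, hm, -⟩ := Option.map_eq_some_iff.1 hv
      intro k hk
      rcases Nat.lt_succ_iff_lt_or_eq.1 hk with hk | rfl
      · exact ih hv' k hk
      · rw [hm, h k m hm]
  rw [blocksOpt_eq this] at hv
  exact (Option.some.inj hv).symm

/-- If the numbers `n k` are detected from the initial segments of a string, a name with the
blocks `n k` can be computed from it. With the length `⟨K, _⟩` of the word that has been read,
one tries to write `K` blocks; each `K` occurs for arbitrarily long words. -/
lemma exists_generates_blocks {A : List Bool → ℕ → Option ℕ} (hA : Computable₂ A) :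
    ∃ h : List Bool → List Bool, Computable h ∧ ∀ (X : Cantor) (n : ℕ → ℕ),
      (∀ k, Detects (fun l => A (initSeg X l) k) (n k)) →
        ∃ q, Generates (fun w => Part.some (h w)) X q ∧ ∀ k, IsInit (blocks n k) q := by
  refine ⟨fun w => (blocksOpt (A w) w.length.unpair.1).getD [], ?_, ?_⟩
  · refine Computable.option_getD ?_ (Computable.const _)
    unfold blocksOpt
    refine Computable.nat_rec (h := fun (w : List Bool) (x : ℕ × Option (List Bool)) =>
      x.2.bind fun v => (A w x.1).map fun m =>
        v ++ [false] ++ (List.range (m + 1)).map fun _ => true)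
      (Computable.fst.comp (Computable.unpair.comp Computable.list_length))
      (Computable.const _) ?_
    refine Computable.option_bind (Computable.snd.comp Computable.snd) ?_
    refine Computable.option_map (hA.comp (Computable.fst.comp Computable.fst)
      (Computable.fst.comp (Computable.snd.comp Computable.fst))) ?_
    refine Computable.list_append.comp (Computable.list_append.comp
      (Computable.snd.comp Computable.fst) (Computable.const _)) ?_
    have hr : Primrec fun m => (List.range (m + 1)).map fun _ => true :=
      Primrec.list_map (Primrec.list_range.comp Primrec.succ) (Primrec.const true).to₂
    exact hr.to_comp.comp Computable.snd
  · intro X n hn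
    obtain ⟨q, hq⟩ := exists_name n
    refine ⟨q, ⟨fun l v hv => ?_, fun K => ?_⟩, hq⟩
    · rw [Part.mem_some_iff] at hv
      rw [hv]
      change IsInit ((blocksOpt (A (initSeg X l)) (initSeg X l).length.unpair.1).getD []) q
      cases hb : blocksOpt (A (initSeg X l)) (initSeg X l).length.unpair.1 with
      | none => exact rfl
      | some v =>
        rw [Option.getD_some, eq_blocks_of_blocksOpt (fun k m => (hn k).1 l m) hb]
        exact hq _
    · have : ∀ᶠ l in atTop, ∀ k < K, A (initSeg X l) k = some (n k) :=
        (Set.finite_lt_nat K).eventually_all.2 fun k _ => (hn k).2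
      obtain ⟨N, hN⟩ := eventually_atTop.1 this
      refine ⟨Nat.pair K N, _, Part.mem_some _, ?_⟩
      simp only [length_initSeg, Nat.unpair_pair]
      rw [blocksOpt_eq (hN _ (Nat.right_le_pair K N))]
      exact le_length_blocks n K

/-! ### Rearranging strings -/

/-- The word consisting of the symbols of `w` at the positions `g 0, g 1, …`, as far as these
lie in `w`. -/
def subword (g : ℕ → ℕ) (w : List Bool) : List Bool :=
  (List.range w.length).filterMap fun m => w[g m]?

lemma filterMap_initSeg {g : ℕ → ℕ} (hg : Monotone g) (X : Cantor) (n N : ℕ) :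
    ∃ l, (List.range N).filterMap (fun m => (initSeg X n)[g m]?) = initSeg (fun m => X (g m)) l ∧
      (l = N ∨ l < N ∧ n ≤ g l) := by
  induction N with
  | zero => exact ⟨0, by simp [initSeg], Or.inl rfl⟩
  | succ N ih =>
    obtain ⟨l, hl, h⟩ := ih
    rw [List.range_succ, List.filterMap_append, hl]
    rcases h with rfl | ⟨h1, h2⟩
    · by_cases h : g l < n
      · exact ⟨l + 1, by simp [initSeg_succ, getElem?_initSeg, h], Or.inl rfl⟩
      · exact ⟨l, by simp [getElem?_initSeg, h], Or.inr ⟨l.lt_succ_self, not_lt.1 h⟩⟩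
    · have h : ¬ g N < n := not_lt.2 (h2.trans (hg h1.le))
      exact ⟨l, by simp [getElem?_initSeg, h], Or.inr ⟨h1.trans N.lt_succ_self, h2⟩⟩

lemma approaches_subword {g : ℕ → ℕ} (hg : Monotone g) (X : Cantor) :
    Approaches (fun n => subword g (initSeg X n)) (fun m => X (g m)) := by
  refine ⟨fun n => ?_, tendsto_atTop.2 fun L => ?_⟩
  · obtain ⟨l, hl, -⟩ := filterMap_initSeg hg X n (initSeg X n).length
    simp only [subword, hl]
    exact isInit_initSeg _ l
  · filter_upwards [eventually_gt_atTop (g L), eventually_ge_atTop L] with n h1 h2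
    obtain ⟨l, hl, h⟩ := filterMap_initSeg hg X n (initSeg X n).length
    have hl' : (subword g (initSeg X n)).length = l := by rw [subword.eq_def, hl, length_initSeg]
    rw [hl']
    rw [length_initSeg] at h
    rcases h with rfl | ⟨-, h⟩
    · exact h2
    · by_contra! hL
      exact (h1.trans_le h).not_ge (hg hL.le)

lemma primrec_subword {α : Type*} [Primcodable α] {g : α → ℕ → ℕ} (hg : Primrec₂ g) :
    Primrec₂ fun a w => subword (g a) w := by
  unfold subword
  exact Primrec.listFilterMap (Primrec.list_range.comp (Primrec.list_length.comp Primrec.snd))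
    (Primrec.list_getElem?.comp (Primrec.snd.comp Primrec.fst)
      (hg.comp (Primrec.fst.comp Primrec.fst) Primrec.snd)).to₂

/-- The string whose symbol number `n` is prescribed by `κ n`, or else is the symbol number
`t n` of `s`. -/
def rewire (κ : ℕ → Option Bool) (t : ℕ → ℕ) (s : Cantor) : Cantor :=
  fun n => (κ n).getD (s (t n))

/-- If `t n ≤ n`, an initial segment of `s` determines the initial segment of `rewire κ t s` of
the same length. -/
lemma exists_generates_rewire {κ : ℕ → Option Bool} {t : ℕ → ℕ} (hκ : Primrec κ)
    (ht : Primrec t) (hle : ∀ n, t n ≤ n) :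
    ∃ h : List Bool → List Bool, Computable h ∧ (∀ v w, v <+: w → h v <+: h w) ∧
      ∀ s, Generates (fun w => Part.some (h w)) s (rewire κ t s) := by
  let h : List Bool → List Bool := fun w =>
    (List.range w.length).map fun n => (κ n).getD (w.getD (t n) false)
  have key : ∀ (s : Cantor) (m : ℕ), h (initSeg s m) = initSeg (rewire κ t s) m := by
    intro s m
    refine List.ext_getElem (by simp [h]) fun n h1 h2 => ?_
    rw [length_initSeg] at h2
    have : t n < m := (hle n).trans_lt h2
    simp [h, initSeg, rewire, this]
  refine ⟨h, ?_, ?_, ?_⟩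
  · refine Primrec.to_comp (Primrec.list_map (Primrec.list_range.comp Primrec.list_length) ?_)
    exact (Primrec.option_getD.comp (hκ.comp Primrec.snd)
      ((Primrec.list_getD false).comp Primrec.fst (ht.comp Primrec.snd))).to₂
  · intro v w hvw
    obtain ⟨p, hp⟩ := exists_isInit w
    have hv := hp.of_prefix hvw
    rw [isInit_iff] at hp hv
    rw [hp, hv, key, key]
    exact initSeg_prefix _ hvw.length_le
  · intro s
    refine ⟨fun n v hv => ?_, fun k => ⟨k, _, Part.mem_some _, ?_⟩⟩
    · rw [Part.mem_some_iff] at hv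
      rw [hv, key]
      exact isInit_initSeg _ n
    · rw [key, length_initSeg]

lemma computableFun_rewire {κ : ℕ → Option Bool} {t : ℕ → ℕ} (hκ : Primrec κ)
    (ht : Primrec t) (hle : ∀ n, t n ≤ n) :
    ComputableFun fun s => Part.some (rewire κ t s) := by
  obtain ⟨h, hc, hm, hg⟩ := exists_generates_rewire hκ ht hle
  refine ⟨h, hc, hm, fun p q => ?_⟩
  rw [Part.mem_some_iff]
  exact ⟨fun e => e ▸ hg p, fun e => e.unique (hg p)⟩

/-! ### Programs for function space names -/

lemma exists_wordFun_eq {h : List Bool → List Bool} (hh : Computable h) :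
    ∃ c, wordFun c = fun w => Part.some (h w) := by
  obtain ⟨c, hc⟩ := Nat.Partrec.Code.exists_code.1 hh
  refine ⟨c, funext fun w => ?_⟩
  simp [wordFun, hc, Encodable.encodek]

/-- A program `c` such that `⟨c, r⟩` is a name of the function realized by `y ↦ Φ ⟨r, y⟩`,
where `Φ` is given by the word function `h`. -/
lemma exists_eta {h : List Bool → List Bool} (hh : Computable h) :
    ∃ c : ℕ, ∀ r y q, Generates (fun w => Part.some (h w)) (pairStr r y) q →
      Eta (pairStr (natStr c) r) y q := by
  obtain ⟨c, hc⟩ := exists_wordFun_eq hh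
  exact ⟨Encodable.encode c, fun r y q hq => ⟨c, r, rfl, hc ▸ hq⟩⟩

lemma primrec_decide_lt {f : ℕ → ℕ} (hf : Primrec f) (c : ℕ) :
    Primrec fun n => decide (f n < c) :=
  (PrimrecRel.comp Primrec.nat_lt hf (Primrec.const c)).decide

lemma primrec_mod_eq_zero (d : ℕ) : PrimrecPred fun n : ℕ => n % d = 0 :=
  PrimrecRel.comp Primrec.eq (Primrec.nat_mod.comp Primrec.id (Primrec.const d))
    (Primrec.const 0)

/-- Currying: a program `c` such that `⟨c, r⟩` names the map from `y` to the string `⟨d, ⟨r, y⟩⟩`,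
which is again a name in a function space representation. -/
lemma exists_eta_curry (d : ℕ) :
    ∃ c : ℕ, ∀ r y, Eta (pairStr (natStr c) r) y (pairStr (natStr d) (pairStr r y)) := by
  obtain ⟨h, hc, -, hg⟩ := exists_generates_rewire
    (κ := fun n => if n % 2 = 0 then some (decide (n / 2 < d)) else none) (t := fun n => n / 2)
    (Primrec.ite (primrec_mod_eq_zero 2)
      (Primrec.option_some.comp (primrec_decide_lt Primrec.nat_div2 d)) (Primrec.const none))
    Primrec.nat_div2 (fun n => Nat.div_le_self n 2)
  obtain ⟨c, hc⟩ := exists_eta hc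
  refine ⟨c, fun r y => hc r y _ ?_⟩
  convert hg (pairStr r y) using 1
  funext n
  by_cases hn : n % 2 = 0 <;> simp [rewire, pairStr, natStr, hn]

/-- The map `s ↦ ⟨⟨c, s⟩, q⟩`, where `s = ⟨p, q⟩`, is computable. -/
lemma computableFun_pairStr (c : ℕ) :
    ComputableFun fun s =>
      Part.some (pairStr (pairStr (natStr c) s) fun n => s (2 * n + 1)) := by
  have hd : Primrec fun n : ℕ => n / 4 := Primrec.nat_div.comp Primrec.id (Primrec.const 4)
  have hF := computableFun_rewire
    (κ := fun n => if n % 4 = 0 then some (decide (n / 4 < c)) else none)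
    (t := fun n => if n % 2 = 0 then n / 4 else n)
    (Primrec.ite (primrec_mod_eq_zero 4)
      (Primrec.option_some.comp (primrec_decide_lt hd c)) (Primrec.const none))
    (Primrec.ite (primrec_mod_eq_zero 2) hd Primrec.id) (fun n => by split_ifs <;> omega)
  refine Eq.mpr (congrArg ComputableFun (funext fun s => congrArg Part.some ?_)) hF
  funext n
  by_cases h2 : n % 2 = 0
  · have h : n / 2 / 2 = n / 4 := by omega
    by_cases h4 : n / 2 % 2 = 0
    · have h' : n % 4 = 0 := by omega
      simp [rewire, pairStr, natStr, h2, h4, h', h]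
    · have h' : n % 4 ≠ 0 := by omega
      simp [rewire, pairStr, h2, h4, h', h]
  · have h' : n % 4 ≠ 0 := by omega
    have h : 2 * (n / 2) + 1 = n := by omega
    simp [rewire, pairStr, h2, h', h]

/-! ### Total approximation functions -/

lemma dist_le_of_name {X : Type*} [MetricSpace X] {α : ℕ → X} {x : X} {n : ℕ → ℕ}
    (hd : ∀ i j, i < j → dist (α (n i)) (α (n j)) < (1 / 2 : ℝ) ^ i)
    (hx : Tendsto (fun i => α (n i)) atTop (𝓝 x)) (k : ℕ) :
    dist (α (n k)) x ≤ (1 / 2 : ℝ) ^ k := by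
  refine le_of_tendsto (tendsto_const_nhds.dist hx) ?_
  filter_upwards [eventually_gt_atTop k] with j hj
  exact (hd k j hj).le

/-- Approximations to the members of a computable sequence of points of metric spaces can be
computed by a total function of natural numbers. -/
lemma ComputableSeq.exists_approx {X : ℕ → Type*} [∀ n, MetricSpace (X n)]
    {α : ∀ n, ℕ → X n} {x : ∀ n, X n} (h : ComputableSeq (fun n => cauchyRep (α n)) x) :
    ∃ D : ℕ → ℕ → ℕ, Computable₂ D ∧ ∀ n k, dist (α n (D n k)) (x n) ≤ (1 / 2 : ℝ) ^ k := by
  obtain ⟨F, ⟨h, hc, hm, hF⟩, hx⟩ := h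
  let f : ℕ × ℕ → ℕ → Option ℕ := fun a l =>
    (runAt (h (initSeg (natStr a.1) l)) (a.2 + 1)).map Nat.pred
  have hf : Computable₂ f := by
    have hi : Primrec fun a : (ℕ × ℕ) × ℕ => initSeg (natStr a.1.1) a.2 := by
      unfold initSeg natStr
      refine Primrec.list_map (Primrec.list_range.comp Primrec.snd) ?_
      exact PrimrecRel.decide (PrimrecRel.comp₂ Primrec.nat_lt Primrec₂.right
        ((Primrec.fst.comp (Primrec.fst.comp Primrec.fst))).to₂)
    refine Computable.option_map (primrec_runAt.to_comp.comp (hc.comp hi.to_comp)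
      (Computable.succ.comp (Computable.snd.comp Computable.fst))) ?_
    exact (Computable.pred.comp Computable.snd).to₂
  have key : ∀ a : ℕ × ℕ, ∃ m ∈ Nat.rfindOpt (f a),
      dist (α a.1 m) (x a.1) ≤ (1 / 2 : ℝ) ^ a.2 := by
    intro a
    obtain ⟨q, hq, n, hn, hd, hl⟩ := hx a.1
    have ha := (((hF _ _).1 hq).approaches hm).detects_block hn a.2
    have hdom : (Nat.rfindOpt (f a)).Dom := by
      obtain ⟨l, hl⟩ := ha.2.exists
      exact Nat.rfindOpt_dom.2 ⟨l, _, hl⟩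
    refine ⟨_, Part.get_mem hdom, ?_⟩
    obtain ⟨l, hl'⟩ := Nat.rfindOpt_spec (Part.get_mem hdom)
    rw [ha.1 l _ hl']
    exact dist_le_of_name hd hl a.2
  choose m hm hmd using key
  refine ⟨fun n k => m (n, k), ?_, fun n k => hmd (n, k)⟩
  exact (Partrec.rfindOpt hf).of_eq fun a => Part.eq_some_iff.2 (hm a)

/-! ### Arithmetic of rational numbers on their indices -/

/-- Negation on indices of rational numbers. -/
def ratNeg (n : ℕ) : ℕ :=
  Nat.pair (Nat.pair n.unpair.1.unpair.2 n.unpair.1.unpair.1) n.unpair.2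

/-- Addition on indices of rational numbers. -/
def ratAdd (m n : ℕ) : ℕ :=
  Nat.pair
    (Nat.pair (m.unpair.1.unpair.1 * (n.unpair.2 + 1) + n.unpair.1.unpair.1 * (m.unpair.2 + 1))
      (m.unpair.1.unpair.2 * (n.unpair.2 + 1) + n.unpair.1.unpair.2 * (m.unpair.2 + 1)))
    (m.unpair.2 * n.unpair.2 + m.unpair.2 + n.unpair.2)

/-- Multiplication on indices of rational numbers. -/
def ratMul (m n : ℕ) : ℕ :=
  Nat.pair
    (Nat.pair
      (m.unpair.1.unpair.1 * n.unpair.1.unpair.1 + m.unpair.1.unpair.2 * n.unpair.1.unpair.2)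
      (m.unpair.1.unpair.1 * n.unpair.1.unpair.2 + m.unpair.1.unpair.2 * n.unpair.1.unpair.1))
    (m.unpair.2 * n.unpair.2 + m.unpair.2 + n.unpair.2)

/-- An index of `1 / 2`. -/
def ratHalf : ℕ := Nat.pair (Nat.pair 1 0) 1

lemma ratNum_ratNeg (n : ℕ) : ratNum (ratNeg n) = -ratNum n := by
  simp only [ratNum, ratNeg, Nat.unpair_pair]
  ring

lemma ratNum_ratAdd (m n : ℕ) : ratNum (ratAdd m n) = ratNum m + ratNum n := by
  simp only [ratNum, ratAdd, Nat.unpair_pair]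
  push_cast
  have hm : (m.unpair.2 : ℝ) + 1 ≠ 0 := by positivity
  have hn : (n.unpair.2 : ℝ) + 1 ≠ 0 := by positivity
  rw [div_add_div _ _ hm hn]
  congr 1 <;> ring

lemma ratNum_ratMul (m n : ℕ) : ratNum (ratMul m n) = ratNum m * ratNum n := by
  simp only [ratNum, ratMul, Nat.unpair_pair]
  push_cast
  rw [div_mul_div_comm]
  congr 1 <;> ring

lemma ratNum_ratHalf : ratNum ratHalf = 1 / 2 := by
  norm_num [ratNum, ratHalf, Nat.unpair_pair]

lemma ratNum_zero : ratNum 0 = 0 := by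
  simp [ratNum]

lemma ratNum_le (n : ℕ) : ratNum n ≤ n := by
  rw [ratNum, div_le_iff₀ (by positivity)]
  have h : n.unpair.1.unpair.1 ≤ n := (Nat.unpair_left_le _).trans (Nat.unpair_left_le _)
  have h : (n.unpair.1.unpair.1 : ℝ) ≤ n := by exact_mod_cast h
  have : (0 : ℝ) ≤ n * n.unpair.2 := by positivity
  have : (0 : ℝ) ≤ n.unpair.1.unpair.2 := by positivity
  nlinarith

lemma primrec_unpair_fst : Primrec fun n : ℕ => n.unpair.1 := Primrec.fst.comp Primrec.unpair

lemma primrec_unpair_snd : Primrec fun n : ℕ => n.unpair.2 := Primrec.snd.comp Primrec.unpair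

lemma primrec_ratNeg : Primrec ratNeg :=
  Primrec₂.natPair.comp
    (Primrec₂.natPair.comp (primrec_unpair_snd.comp primrec_unpair_fst)
      (primrec_unpair_fst.comp primrec_unpair_fst)) primrec_unpair_snd

lemma primrec_ratAdd : Primrec₂ ratAdd := by
  have a {f : ℕ × ℕ → ℕ} (hf : Primrec f) := primrec_unpair_fst.comp (primrec_unpair_fst.comp hf)
  have b {f : ℕ × ℕ → ℕ} (hf : Primrec f) := primrec_unpair_snd.comp (primrec_unpair_fst.comp hf)
  have c {f : ℕ × ℕ → ℕ} (hf : Primrec f) := primrec_unpair_snd.comp hf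
  have d {f : ℕ × ℕ → ℕ} (hf : Primrec f) := Primrec.succ.comp (c hf)
  have add {f g : ℕ × ℕ → ℕ} (hf : Primrec f) (hg : Primrec g) := Primrec.nat_add.comp hf hg
  have mul {f g : ℕ × ℕ → ℕ} (hf : Primrec f) (hg : Primrec g) := Primrec.nat_mul.comp hf hg
  have x : Primrec fun p : ℕ × ℕ => p.1 := Primrec.fst
  have y : Primrec fun p : ℕ × ℕ => p.2 := Primrec.snd
  exact Primrec₂.natPair.comp
    (Primrec₂.natPair.comp (add (mul (a x) (d y)) (mul (a y) (d x)))
      (add (mul (b x) (d y)) (mul (b y) (d x))))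
    (add (add (mul (c x) (c y)) (c x)) (c y))

lemma primrec_ratMul : Primrec₂ ratMul := by
  have a {f : ℕ × ℕ → ℕ} (hf : Primrec f) := primrec_unpair_fst.comp (primrec_unpair_fst.comp hf)
  have b {f : ℕ × ℕ → ℕ} (hf : Primrec f) := primrec_unpair_snd.comp (primrec_unpair_fst.comp hf)
  have c {f : ℕ × ℕ → ℕ} (hf : Primrec f) := primrec_unpair_snd.comp hf
  have add {f g : ℕ × ℕ → ℕ} (hf : Primrec f) (hg : Primrec g) := Primrec.nat_add.comp hf hg
  have mul {f g : ℕ × ℕ → ℕ} (hf : Primrec f) (hg : Primrec g) := Primrec.nat_mul.comp hf hg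
  have x : Primrec fun p : ℕ × ℕ => p.1 := Primrec.fst
  have y : Primrec fun p : ℕ × ℕ => p.2 := Primrec.snd
  exact Primrec₂.natPair.comp
    (Primrec₂.natPair.comp (add (mul (a x) (a y)) (mul (b x) (b y)))
      (add (mul (a x) (b y)) (mul (b x) (a y))))
    (add (add (mul (c x) (c y)) (c x)) (c y))

/-! ### Multiplication by the imaginary unit on indices -/

/-- Multiplication by `i` on indices of rational complex numbers. -/
def scalarMulI (n : ℕ) : ℕ := Nat.pair (ratNeg n.unpair.2) n.unpair.1

lemma primrec_scalarMulI : Primrec scalarMulI :=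
  Primrec₂.natPair.comp (primrec_ratNeg.comp primrec_unpair_snd) primrec_unpair_fst

/-- Application of `scalarMulI` to the entries `0, …, i` of a tuple `m = ⟨n_0, …, n_k⟩`; the
tuple `⟨n_0, …, n_i⟩` is obtained from `m` by taking the first component `k - i` times. -/
def tupleMulI (m k i : ℕ) : ℕ :=
  Nat.rec (scalarMulI ((fun n => n.unpair.1)^[k] m))
    (fun i t => Nat.pair t (scalarMulI ((fun n => n.unpair.1)^[k - (i + 1)] m).unpair.2)) i

/-- Multiplication by `i` on indices of linear combinations. -/
def spanMulI (n : ℕ) : ℕ :=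
  Nat.pair n.unpair.1 (tupleMulI n.unpair.2 n.unpair.1 n.unpair.1)

lemma primrec_spanMulI : Primrec spanMulI := by
  have hit : Primrec₂ fun (k m : ℕ) => (fun n : ℕ => n.unpair.1)^[k] m :=
    Primrec.nat_iterate Primrec.fst Primrec.snd (primrec_unpair_fst.comp Primrec.snd).to₂
  have h0 : Primrec fun n : ℕ =>
      scalarMulI ((fun n => n.unpair.1)^[n.unpair.1] n.unpair.2) :=
    primrec_scalarMulI.comp (hit.comp primrec_unpair_fst primrec_unpair_snd)
  have hk : Primrec fun a : ℕ × ℕ × ℕ => a.1.unpair.1 - (a.2.1 + 1) :=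
    Primrec.nat_sub.comp (primrec_unpair_fst.comp Primrec.fst)
      (Primrec.succ.comp (Primrec.fst.comp Primrec.snd))
  have hs : Primrec₂ fun (n : ℕ) (x : ℕ × ℕ) => Nat.pair x.2
      (scalarMulI ((fun n => n.unpair.1)^[n.unpair.1 - (x.1 + 1)] n.unpair.2).unpair.2) :=
    Primrec₂.natPair.comp (Primrec.snd.comp Primrec.snd) (primrec_scalarMulI.comp
      (primrec_unpair_snd.comp (hit.comp hk (primrec_unpair_snd.comp Primrec.fst))))
  have hr := Primrec.nat_rec' primrec_unpair_fst h0 hs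
  have ht : Primrec fun n : ℕ => tupleMulI n.unpair.2 n.unpair.1 n.unpair.1 := hr
  exact Primrec₂.natPair.comp primrec_unpair_fst ht

section Hilbert

variable {𝕜 : Type*} [RCLike 𝕜]

lemma scalarNum_zero : scalarNum 𝕜 0 = 0 := by
  simp [scalarNum, ratNum_zero]

lemma scalarNum_scalarMulI (hI : (RCLike.I : 𝕜) ≠ 0) (n : ℕ) :
    scalarNum 𝕜 (scalarMulI n) = RCLike.I * scalarNum 𝕜 n := by
  simp only [scalarNum, hI, if_false, scalarMulI, Nat.unpair_pair, ratNum_ratNeg]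
  push_cast
  linear_combination (-(ratNum n.unpair.2 : 𝕜)) * RCLike.I_mul_I_of_nonzero hI

section

variable {H : Type*} [NormedAddCommGroup H] [InnerProductSpace 𝕜 H]

lemma linComb_tupleMulI (hI : (RCLike.I : 𝕜) ≠ 0) (e : ℕ → H) (m k : ℕ) {i : ℕ} (hi : i ≤ k) :
    linComb 𝕜 e i (tupleMulI m k i) =
      (RCLike.I : 𝕜) • linComb 𝕜 e i ((fun n => n.unpair.1)^[k - i] m) := by
  induction i with
  | zero => simp [linComb, tupleMulI, scalarNum_scalarMulI hI, mul_smul]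
  | succ i ih =>
    have hk : k - i = (k - (i + 1)) + 1 := by omega
    have ih := ih (by omega)
    rw [hk, Function.iterate_succ_apply'] at ih
    have ht : tupleMulI m k (i + 1) = Nat.pair (tupleMulI m k i)
      (scalarMulI ((fun n => n.unpair.1)^[k - (i + 1)] m).unpair.2) := rfl
    rw [ht]
    simp only [linComb, Nat.unpair_pair, ih, scalarNum_scalarMulI hI, mul_smul, smul_add]

lemma spanNum_spanMulI (hI : (RCLike.I : 𝕜) ≠ 0) (e : ℕ → H) (n : ℕ) :
    spanNum 𝕜 e (spanMulI n) = (RCLike.I : 𝕜) • spanNum 𝕜 e n := by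
  simp only [spanNum, spanMulI, Nat.unpair_pair]
  simpa using linComb_tupleMulI hI e n.unpair.2 n.unpair.1 le_rfl

lemma spanNum_zero (e : ℕ → H) : spanNum 𝕜 e 0 = 0 := by
  simp [spanNum, linComb, scalarNum_zero]

end

/-! ### Inner products of linear combinations -/

/-- The index of `(x² + y² - z²) / 2`. By the polarization identity this is the real part of
an inner product if `x`, `y` and `z` are the norms of the factors and of their difference. -/
def ratPolar (x y z : ℕ) : ℕ :=
  ratMul ratHalf (ratAdd (ratAdd (ratMul x x) (ratMul y y)) (ratNeg (ratMul z z)))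

lemma ratNum_ratPolar (x y z : ℕ) :
    ratNum (ratPolar x y z) = (ratNum x ^ 2 + ratNum y ^ 2 - ratNum z ^ 2) / 2 := by
  simp only [ratPolar, ratNum_ratMul, ratNum_ratAdd, ratNum_ratNeg, ratNum_ratHalf]
  ring

lemma computable_ratPolar {α : Type*} [Primcodable α] {x y z : α → ℕ} (hx : Computable x)
    (hy : Computable y) (hz : Computable z) :
    Computable fun a => ratPolar (x a) (y a) (z a) := by
  have mul {f g : α → ℕ} (hf : Computable f) (hg : Computable g) :=
    primrec_ratMul.to_comp.comp hf hg
  have add {f g : α → ℕ} (hf : Computable f) (hg : Computable g) :=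
    primrec_ratAdd.to_comp.comp hf hg
  exact mul (Computable.const _) (add (add (mul hx hx) (mul hy hy))
    (primrec_ratNeg.to_comp.comp (mul hz hz)))

lemma abs_sq_sub_sq_le {a d ε : ℝ} (hd : 0 ≤ d) (hε : ε ≤ 1) (h : |a - d| ≤ ε) :
    |a ^ 2 - d ^ 2| ≤ ε * (2 * d + 1) := by
  have h1 : a ^ 2 - d ^ 2 = (a - d) * (a + d) := by ring
  have h2 : |a + d| ≤ 2 * d + 1 := by
    rw [abs_le] at h ⊢
    constructor <;> linarith [h.1, h.2]
  rw [h1, abs_mul]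
  exact mul_le_mul h h2 (abs_nonneg _) ((abs_nonneg _).trans h)

variable {H : ℕ → Type*} [∀ i, NormedAddCommGroup (H i)] [∀ i, InnerProductSpace 𝕜 (H i)]

/-- Distances between linear combinations, hence also norms, can be approximated uniformly. -/
lemma IsComputableHilbertSeq.exists_dist {u : ∀ i, ℕ → H i} (hu : IsComputableHilbertSeq 𝕜 u) :
    ∃ D : ℕ × ℕ × ℕ × ℕ → ℕ, Computable D ∧ ∀ i x y k,
      |ratNum (D (i, x, y, k)) - ‖spanNum 𝕜 (u i) x - spanNum 𝕜 (u i) y‖| ≤ (1 / 2 : ℝ) ^ k := by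
  obtain ⟨D, hD, h⟩ := ComputableSeq.exists_approx (X := fun _ => ℝ)
    (α := fun _ => ratNum) hu.uniform
  refine ⟨fun a => D (Nat.pair a.1 (Nat.pair a.2.1 a.2.2.1)) a.2.2.2, ?_, fun i x y k => ?_⟩
  · have pair {f g : ℕ × ℕ × ℕ × ℕ → ℕ} (hf : Computable f) (hg : Computable g) :=
      Primrec₂.natPair.to_comp.comp hf hg
    exact hD.comp (pair Computable.fst (pair (Computable.fst.comp Computable.snd)
      (Computable.fst.comp (Computable.snd.comp Computable.snd))))
      (Computable.snd.comp (Computable.snd.comp Computable.snd))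
  · have h := h (Nat.pair i (Nat.pair x y)) k
    rw [Nat.unpair_pair] at h
    simpa only [Real.dist_eq, Real.norm_eq_abs, Nat.unpair_pair, dist_eq_norm] using h

lemma IsComputableHilbertSeq.exists_re_inner {u : ∀ i, ℕ → H i}
    (hu : IsComputableHilbertSeq 𝕜 u) :
    ∃ R : ℕ × ℕ × ℕ × ℕ → ℕ, Computable R ∧ ∀ i x y k,
      |ratNum (R (i, x, y, k)) -
          RCLike.re (inner 𝕜 (spanNum 𝕜 (u i) x) (spanNum 𝕜 (u i) y))| ≤
        (1 / 2 : ℝ) ^ k * (2 * (‖spanNum 𝕜 (u i) x‖ + ‖spanNum 𝕜 (u i) y‖ + 1)) := by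
  obtain ⟨D, hD, h⟩ := hu.exists_dist
  refine ⟨fun a => ratPolar (D (a.1, a.2.1, 0, a.2.2.2)) (D (a.1, a.2.2.1, 0, a.2.2.2)) (D a),
    ?_, fun i x y k => ?_⟩
  · have c1 : Computable fun a : ℕ × ℕ × ℕ × ℕ => a.2.1 := Computable.fst.comp Computable.snd
    have c2 : Computable fun a : ℕ × ℕ × ℕ × ℕ => a.2.2.1 :=
      Computable.fst.comp (Computable.snd.comp Computable.snd)
    have c3 : Computable fun a : ℕ × ℕ × ℕ × ℕ => a.2.2.2 :=
      Computable.snd.comp (Computable.snd.comp Computable.snd)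
    exact computable_ratPolar
      (hD.comp (Computable.fst.pair (c1.pair ((Computable.const 0).pair c3))))
      (hD.comp (Computable.fst.pair (c2.pair ((Computable.const 0).pair c3)))) hD
  · have hx := h i x 0 k
    have hy := h i y 0 k
    have hz := h i x y k
    rw [spanNum_zero, sub_zero] at hx hy
    rw [re_inner_eq_norm_mul_self_add_norm_mul_self_sub_norm_sub_mul_self_div_two]
    simp only [ratNum_ratPolar]
    set X := spanNum 𝕜 (u i) x
    set Y := spanNum 𝕜 (u i) y
    have hε : (1 / 2 : ℝ) ^ k ≤ 1 := pow_le_one₀ (by norm_num) (by norm_num)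
    have hε0 : 0 ≤ (1 / 2 : ℝ) ^ k := by positivity
    have ex := abs_le.1 (abs_sq_sub_sq_le (norm_nonneg _) hε hx)
    have ey := abs_le.1 (abs_sq_sub_sq_le (norm_nonneg _) hε hy)
    have ez := abs_le.1 (abs_sq_sub_sq_le (norm_nonneg _) hε hz)
    have hs := mul_le_mul_of_nonneg_left (norm_sub_le X Y) hε0
    rw [abs_le]
    constructor <;> linarith [ex.1, ex.2, ey.1, ey.2, ez.1, ez.2]

/-- Inner products of linear combinations can be approximated uniformly. For complex scalars,
the imaginary part of `⟨x, y⟩` is the real part of `⟨i x, y⟩`. -/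
lemma IsComputableHilbertSeq.exists_inner {u : ∀ i, ℕ → H i}
    (hu : IsComputableHilbertSeq 𝕜 u) :
    ∃ R : ℕ × ℕ × ℕ × ℕ → ℕ, Computable R ∧ ∀ i x y k,
      ‖scalarNum 𝕜 (R (i, x, y, k)) - inner 𝕜 (spanNum 𝕜 (u i) x) (spanNum 𝕜 (u i) y)‖ ≤
        (1 / 2 : ℝ) ^ k * (4 * (‖spanNum 𝕜 (u i) x‖ + ‖spanNum 𝕜 (u i) y‖ + 1)) := by
  obtain ⟨R, hR, h⟩ := hu.exists_re_inner
  by_cases hI : (RCLike.I : 𝕜) = 0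
  · refine ⟨R, hR, fun i x y k => ?_⟩
    have hz := RCLike.re_add_im (inner 𝕜 (spanNum 𝕜 (u i) x) (spanNum 𝕜 (u i) y))
    rw [hI, mul_zero, add_zero] at hz
    simp only [scalarNum, hI, if_true]
    rw [← hz, ← RCLike.ofReal_sub, RCLike.norm_ofReal]
    refine (h i x y k).trans (mul_le_mul_of_nonneg_left ?_ (by positivity))
    linarith [norm_nonneg (spanNum 𝕜 (u i) x), norm_nonneg (spanNum 𝕜 (u i) y)]
  · refine ⟨fun a => Nat.pair (R a) (R (a.1, spanMulI a.2.1, a.2.2)), ?_, fun i x y k => ?_⟩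
    · exact Primrec₂.natPair.to_comp.comp hR (hR.comp (Computable.fst.pair
        ((primrec_spanMulI.to_comp.comp (Computable.fst.comp Computable.snd)).pair
          (Computable.snd.comp Computable.snd))))
    · have h1 := h i x y k
      have h2 := h i (spanMulI x) y k
      rw [spanNum_spanMulI hI, norm_smul, RCLike.norm_I_of_ne_zero hI, one_mul, inner_smul_left]
        at h2
      set z := inner 𝕜 (spanNum 𝕜 (u i) x) (spanNum 𝕜 (u i) y)
      have him : RCLike.re ((starRingEnd 𝕜) RCLike.I * z) = RCLike.im z := by
        simp [RCLike.mul_re]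
      rw [him] at h2
      simp only [scalarNum, hI, if_false, Nat.unpair_pair]
      have hd : ((ratNum (R (i, x, y, k)) : 𝕜) + (ratNum (R (i, spanMulI x, y, k)) : 𝕜) *
          RCLike.I) - z = ((ratNum (R (i, x, y, k)) - RCLike.re z : ℝ) : 𝕜) +
          ((ratNum (R (i, spanMulI x, y, k)) - RCLike.im z : ℝ) : 𝕜) * RCLike.I := by
        conv_lhs => rw [← RCLike.re_add_im z]
        push_cast
        ring
      rw [hd]
      refine (norm_add_le _ _).trans ?_
      rw [norm_mul, RCLike.norm_ofReal, RCLike.norm_ofReal, RCLike.norm_I_of_ne_zero hI, mul_one]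
      linarith

end Hilbert

/-! ### Fourier coefficients -/

section Hilbert

variable {𝕜 : Type*} [RCLike 𝕜]

/-- The entry number `l` of the name of `f_i`, read off from an initial segment `w` of
`⟨⟨s, i⟩, j⟩`, where `s = ⟨⟨p_0, p_1, …⟩, q⟩` and `p_i` is the name of `f_i`. -/
def entryAt (w : List Bool) (i l : ℕ) : Option ℕ :=
  (runAt (subword (fun m => 8 * Nat.pair i m) w) (l + 1)).map Nat.pred

lemma primrec_entryAt : Primrec fun a : List Bool × ℕ × ℕ => entryAt a.1 a.2.1 a.2.2 := by
  have hg : Primrec₂ fun i m : ℕ => 8 * Nat.pair i m :=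
    Primrec.nat_mul.comp (Primrec.const 8) Primrec₂.natPair
  refine Primrec.option_map (primrec_runAt.comp ((primrec_subword hg).comp
    (Primrec.fst.comp Primrec.snd) Primrec.fst)
    (Primrec.succ.comp (Primrec.snd.comp Primrec.snd))) ?_
  exact (Primrec.pred.comp Primrec.snd).to₂

lemma computable_entryAt {α : Type*} [Primcodable α] {w : α → List Bool} {i l : α → ℕ}
    (hw : Computable w) (hi : Computable i) (hl : Computable l) :
    Computable fun a => entryAt (w a) (i a) (l a) := by
  have h := primrec_entryAt.to_comp.comp (hw.pair (hi.pair hl))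
  exact h

lemma detects_entryAt {p q t t' : Cantor} {i : ℕ} {n : ℕ → ℕ}
    (hn : ∀ k, IsInit (blocks n k) (component p i)) (l : ℕ) :
    Detects (fun L => entryAt (initSeg (pairStr (pairStr (pairStr p q) t) t') L) i l) (n l) := by
  have hmono : Monotone fun m => 8 * Nat.pair i m :=
    StrictMono.monotone fun _ _ h =>
      Nat.mul_lt_mul_of_pos_left (Nat.pair_lt_pair_right i h) (by norm_num)
  have hW := approaches_subword hmono (pairStr (pairStr (pairStr p q) t) t')
  have hX : (fun m => pairStr (pairStr (pairStr p q) t) t' (8 * Nat.pair i m)) = component p i := by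
    funext m
    have h1 : 8 * Nat.pair i m % 2 = 0 := by omega
    have h2 : 8 * Nat.pair i m / 2 % 2 = 0 := by omega
    have h3 : 8 * Nat.pair i m / 2 / 2 % 2 = 0 := by omega
    have h4 : 8 * Nat.pair i m / 2 / 2 / 2 = Nat.pair i m := by omega
    simp only [pairStr, component, h1, h2, h3, h4, if_true]
  rw [hX] at hW
  exact hW.detects_block hn l

/-- An attempt to compute an index of a scalar close to `⟨e_ij, f_i⟩` from an initial segment
`w` of `⟨⟨s, i⟩, j⟩`. The function `D` approximates distances, `E` the basis, and `R` inner
products. The approximation `y₀` to `f_i` yields a bound for `‖f_i‖` and thereby the precision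
with which the inner product has to be computed. -/
def coeffAttempt (D R : ℕ × ℕ × ℕ × ℕ → ℕ) (E : ℕ → ℕ → ℕ) (w : List Bool) (k : ℕ) : Option ℕ :=
  (runAt (subword (fun m => 4 * m + 2) w) 0).bind fun i =>
    (runAt (subword (fun m => 2 * m + 1) w) 0).bind fun j =>
      (entryAt w i 0).bind fun y₀ =>
        (entryAt w i (k + D (i, y₀, 0, 0) + 9)).map fun y =>
          R (i, E (Nat.pair i j) (k + D (i, y₀, 0, 0) + 9), y, k + D (i, y₀, 0, 0) + 9)

lemma computable_coeffAttempt {D R : ℕ × ℕ × ℕ × ℕ → ℕ} {E : ℕ → ℕ → ℕ} (hD : Computable D)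
    (hR : Computable R) (hE : Computable₂ E) : Computable₂ (coeffAttempt D R E) := by
  have hn {g : ℕ → ℕ} (hg : Primrec g) :
      Computable fun w => runAt (subword g w) 0 :=
    primrec_runAt.to_comp.comp (((primrec_subword (α := Unit) (g := fun _ => g)
      (hg.comp Primrec.snd).to₂).to_comp.comp (Computable.const ()) Computable.id))
      (Computable.const 0)
  have h2 : Primrec fun m : ℕ => 2 * m + 1 :=
    Primrec.succ.comp (Primrec.nat_mul.comp (Primrec.const 2) Primrec.id)
  have h4 : Primrec fun m : ℕ => 4 * m + 2 :=
    Primrec.succ.comp (Primrec.succ.comp (Primrec.nat_mul.comp (Primrec.const 4) Primrec.id))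
  have hi : Computable fun a : (((List Bool × ℕ) × ℕ) × ℕ) × ℕ => a.1.1.2 :=
    Computable.snd.comp (Computable.fst.comp Computable.fst)
  have hj : Computable fun a : (((List Bool × ℕ) × ℕ) × ℕ) × ℕ => a.1.2 :=
    Computable.snd.comp Computable.fst
  have hl : Computable fun a : (((List Bool × ℕ) × ℕ) × ℕ) × ℕ =>
      a.1.1.1.2 + D (a.1.1.2, a.2, 0, 0) + 9 := by
    have hd := hD.comp (hi.pair (Computable.snd.pair (Computable.const (0, 0))))
    have hk : Computable fun a : (((List Bool × ℕ) × ℕ) × ℕ) × ℕ => a.1.1.1.2 :=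
      Computable.snd.comp (Computable.fst.comp (Computable.fst.comp Computable.fst))
    exact Primrec.nat_add.to_comp.comp (Primrec.nat_add.to_comp.comp hk hd) (Computable.const 9)
  have hx := hE.comp (Primrec₂.natPair.to_comp.comp hi hj) hl
  have hy₀ : Computable fun a : ((List Bool × ℕ) × ℕ) × ℕ => entryAt a.1.1.1 a.1.2 0 :=
    computable_entryAt (Computable.fst.comp (Computable.fst.comp Computable.fst))
      (Computable.snd.comp Computable.fst) (Computable.const 0)
  have hy : Computable fun a : (((List Bool × ℕ) × ℕ) × ℕ) × ℕ =>
      entryAt a.1.1.1.1 a.1.1.2 (a.1.1.1.2 + D (a.1.1.2, a.2, 0, 0) + 9) :=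
    computable_entryAt
      (Computable.fst.comp (Computable.fst.comp (Computable.fst.comp Computable.fst))) hi hl
  have hr : Computable₂ fun (a : (((List Bool × ℕ) × ℕ) × ℕ) × ℕ) (y : ℕ) =>
      R (a.1.1.2, E (Nat.pair a.1.1.2 a.1.2) (a.1.1.1.2 + D (a.1.1.2, a.2, 0, 0) + 9), y,
        a.1.1.1.2 + D (a.1.1.2, a.2, 0, 0) + 9) :=
    hR.comp ((hi.comp Computable.fst).pair ((hx.comp Computable.fst).pair
      (Computable.snd.pair (hl.comp Computable.fst))))
  have h₁ := Computable.option_bind hy₀ (Computable.option_map hy hr).to₂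
  have h₂ := Computable.option_bind ((hn h2).comp (Computable.fst.comp Computable.fst)) h₁.to₂
  exact Computable.option_bind ((hn h4).comp Computable.fst) h₂.to₂

lemma five_mul_add_le (M : ℕ) : (5 * M + 13 : ℝ) ≤ 2 ^ (M + 4) := by
  have h : M + 1 ≤ 2 ^ M := Nat.lt_two_pow_self
  have h : (M + 1 : ℝ) ≤ 2 ^ M := by exact_mod_cast h
  rw [pow_add]
  have : (0 : ℝ) ≤ M := by positivity
  linarith

/-- A sequence approximating `z` with errors at most `2^(-k-2)` satisfies the conditions of the
Cauchy representation. -/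
lemma cauchyRep_of_dist_le {X : Type*} [MetricSpace X] {α : ℕ → X} {z : X} {n : ℕ → ℕ}
    (h : ∀ k, dist (α (n k)) z ≤ (1 / 2 : ℝ) ^ (k + 2)) {q : Cantor}
    (hq : ∀ k, IsInit (blocks n k) q) : cauchyRep α q z := by
  refine ⟨n, hq, fun i j hij => ?_, ?_⟩
  · have h1 : (1 / 2 : ℝ) ^ j ≤ (1 / 2 : ℝ) ^ i :=
      pow_le_pow_of_le_one (by norm_num) (by norm_num) hij.le
    have h2 : 0 < (1 / 2 : ℝ) ^ i := by positivity
    have h3 := dist_triangle_right (α (n i)) (α (n j)) z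
    have hi := h i
    have hj := h j
    rw [pow_add] at hi hj
    linarith
  · rw [tendsto_iff_dist_tendsto_zero]
    refine squeeze_zero (fun _ => dist_nonneg) h ?_
    exact (tendsto_pow_atTop_nhds_zero_of_lt_one (by norm_num) (by norm_num)).comp
      (tendsto_add_atTop_nat 2)

section

variable {H : Type*} [NormedAddCommGroup H] [InnerProductSpace 𝕜 H]

/-- The error of the inner product of approximations `x` to a vector `a` with `‖a‖ ≤ 1` and `y`
to a vector `b`, if it is itself computed approximately. -/
lemma norm_sub_inner_le {a b x y : H} {c : 𝕜} {ε B : ℝ} (ha : ‖a‖ ≤ 1) (hε : ε ≤ 1)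
    (hx : ‖x - a‖ ≤ ε) (hy : ‖y - b‖ ≤ ε) (hB : ‖y‖ ≤ B)
    (hc : ‖c - inner 𝕜 x y‖ ≤ ε * (4 * (‖x‖ + ‖y‖ + 1))) :
    ‖c - inner 𝕜 a b‖ ≤ ε * (5 * B + 13) := by
  have hε0 : 0 ≤ ε := (norm_nonneg _).trans hx
  have h1 : ‖x‖ ≤ 2 := by
    have := norm_add_le (x - a) a
    rw [sub_add_cancel] at this
    linarith
  have h2 : c - inner 𝕜 a b =
      (c - inner 𝕜 x y) + (inner 𝕜 (x - a) y + inner 𝕜 a (y - b)) := by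
    rw [inner_sub_left, inner_sub_right]
    ring
  have h3 : ‖inner 𝕜 (x - a) y‖ ≤ ε * B :=
    (norm_inner_le_norm _ _).trans (mul_le_mul hx hB (norm_nonneg _) hε0)
  have h4 : ‖inner 𝕜 a (y - b)‖ ≤ 1 * ε :=
    (norm_inner_le_norm _ _).trans (mul_le_mul ha hy (norm_nonneg _) zero_le_one)
  have h5 : ε * (4 * (‖x‖ + ‖y‖ + 1)) ≤ ε * (4 * (2 + B + 1)) :=
    mul_le_mul_of_nonneg_left (by linarith) hε0
  rw [h2]
  refine (norm_add_le _ _).trans ?_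
  have h6 := norm_add_le (inner 𝕜 (x - a) y) (inner 𝕜 a (y - b))
  linarith

end

variable {H : ℕ → Type*} [∀ i, NormedAddCommGroup (H i)] [∀ i, InnerProductSpace 𝕜 (H i)]

/-- The Fourier coefficient `⟨e_ij, f_i⟩` can be computed from `⟨⟨s, i⟩, j⟩`, where the first
part of `s` consists of names of the `f_i`. -/
lemma exists_generates_coeff {u e : ∀ i, ℕ → H i} (hu : IsComputableHilbertSeq 𝕜 u)
    (he : IsComputableBasisSeq 𝕜 u e) :
    ∃ h : List Bool → List Bool, Computable h ∧ ∀ (p q : Cantor) (f : ∀ i, H i),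
      (∀ i, hilbertRep 𝕜 (u i) (component p i) (f i)) → ∀ i j,
        ∃ z, Generates (fun w => Part.some (h w))
            (pairStr (pairStr (pairStr p q) (natStr i)) (natStr j)) z ∧
          scalarRep 𝕜 z (inner 𝕜 (e i j) (f i)) := by
  obtain ⟨D, hD, hDd⟩ := hu.exists_dist
  obtain ⟨R, hR, hRd⟩ := hu.exists_inner
  obtain ⟨E, hE, hEd⟩ := ComputableSeq.exists_approx (X := fun n => H n.unpair.1)
    (α := fun n => spanNum 𝕜 (u n.unpair.1)) he.computable
  obtain ⟨h, hc, hh⟩ := exists_generates_blocks (computable_coeffAttempt hD hR hE)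
  refine ⟨h, hc, fun p q f hf i j => ?_⟩
  obtain ⟨n, hn, hcau, hlim⟩ := hf i
  have hnd := dist_le_of_name hcau hlim
  -- `N + 2` is a bound for the norm of `f i`, and `N + 3` for the norms of its approximations.
  set N := D (i, n 0, 0, 0) with hN
  obtain ⟨z, hz, hzn⟩ := hh (pairStr (pairStr (pairStr p q) (natStr i)) (natStr j))
    (fun k => R (i, E (Nat.pair i j) (k + N + 9), n (k + N + 9), k + N + 9)) (fun k => by
      have h4 : Monotone fun m : ℕ => 4 * m + 2 := fun a b h => by dsimp only; omega
      have h2 : Monotone fun m : ℕ => 2 * m + 1 := fun a b h => by dsimp only; omega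
      refine Detects.bind (a := i) ?_ (Detects.bind (a := j) ?_
        (Detects.bind (detects_entryAt hn 0) ((detects_entryAt hn _).map _)))
      · have := approaches_subword h4 (pairStr (pairStr (pairStr p q) (natStr i)) (natStr j))
        refine Approaches.detects_nat ?_
        convert this using 1
        funext m
        have e1 : (4 * m + 2) % 2 = 0 := by omega
        have e2 : (4 * m + 2) / 2 % 2 = 1 := by omega
        have e3 : (4 * m + 2) / 2 / 2 = m := by omega
        simp only [pairStr, e1, e2, e3, if_true, one_ne_zero, if_false]
      · have := approaches_subword h2 (pairStr (pairStr (pairStr p q) (natStr i)) (natStr j))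
        refine Approaches.detects_nat ?_
        convert this using 1
        funext m
        have e1 : (2 * m + 1) % 2 = 1 := by omega
        have e3 : (2 * m + 1) / 2 = m := by omega
        simp [pairStr, e1, e3])
  refine ⟨z, hz, cauchyRep_of_dist_le (fun k => ?_) hzn⟩
  -- The error factor `5 (N + 3) + 13` is at most `2 ^ (N + 7)`, which leaves `2 ^ (-k-2)`.
  set l := k + N + 9 with hl
  have hε : (1 / 2 : ℝ) ^ l ≤ 1 := pow_le_one₀ (by norm_num) (by norm_num)
  have hE' : ‖spanNum 𝕜 (u i) (E (Nat.pair i j) l) - e i j‖ ≤ (1 / 2 : ℝ) ^ l := by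
    have h := hEd (Nat.pair i j) l
    rw [Nat.unpair_pair] at h
    simpa only [dist_eq_norm] using h
  have he1 : ‖e i j‖ ≤ 1 := by
    rcases (he.basis i).norm_eq j with h | h
    · exact h.le
    · simp [h]
  have hy := hnd l
  have hy0 := hnd 0
  rw [dist_eq_norm] at hy hy0
  have hB : ‖spanNum 𝕜 (u i) (n l)‖ ≤ (N + 3 : ℕ) := by
    have h0 := hDd i (n 0) 0 0
    rw [spanNum_zero, sub_zero, ← hN, pow_zero] at h0
    have h1 := ratNum_le N
    have h2 := (abs_le.1 h0).1
    have h3 := norm_sub_norm_le (f i) (spanNum 𝕜 (u i) (n 0))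
    rw [norm_sub_rev] at h3
    have h4 := norm_sub_norm_le (spanNum 𝕜 (u i) (n l)) (f i)
    rw [pow_zero] at hy0
    push_cast
    linarith
  have key := norm_sub_inner_le he1 hε hE' hy hB (hRd i _ (n l) l)
  rw [dist_eq_norm]
  refine key.trans ?_
  calc (1 / 2 : ℝ) ^ l * (5 * ((N + 3 : ℕ) : ℝ) + 13)
      ≤ (1 / 2 : ℝ) ^ l * 2 ^ (N + 3 + 4) :=
        mul_le_mul_of_nonneg_left (five_mul_add_le (N + 3)) (by positivity)
    _ = (1 / 2 : ℝ) ^ (k + 2) := by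
        rw [show l = k + 2 + (N + 3 + 4) by omega, pow_add, mul_assoc, ← mul_pow]
        norm_num

end Hilbert

theorem theorem3p3 {𝕜 : Type*} [RCLike 𝕜] {H : ℕ → Type*}
    [∀ i, NormedAddCommGroup (H i)] [∀ i, InnerProductSpace 𝕜 (H i)]
    (u : ∀ i, ℕ → H i) (hu : IsComputableHilbertSeq 𝕜 u)
    (e : ∀ i, ℕ → H i) (he : IsComputableBasisSeq 𝕜 u e) :
    Reducible (sumRep 𝕜 u) (fourierRep 𝕜 e) := by
  obtain ⟨h, hc, hh⟩ := exists_generates_coeff hu he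
  obtain ⟨c₂, hc₂⟩ := exists_eta hc
  obtain ⟨c₁, hc₁⟩ := exists_eta_curry c₂
  refine ⟨_, computableFun_pairStr c₁, ?_⟩
  rintro _ f ⟨p, q, rfl, hp, hq⟩
  have hodd : (fun n => pairStr p q (2 * n + 1)) = q := by
    funext n
    have e1 : (2 * n + 1) % 2 = 1 := by omega
    have e2 : (2 * n + 1) / 2 = n := by omega
    simp [pairStr, e1, e2]
  refine ⟨_, Part.mem_some _, _, q, by rw [hodd], ?_, hq⟩
  rintro _ i rfl
  refine ⟨_, hc₁ _ _, ?_⟩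
  rintro _ j rfl
  obtain ⟨z, hz, hz'⟩ := hh p q f hp i j
  exact ⟨z, hc₂ _ _ z hz, hz'⟩
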